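/- All spaces are over an algebraically closed field $\mathbb{F}$ of characteristic zero. Let $L=L_{\bar 0}\oplus L_{\bar 1}$ be a finite-dimensional Lie superalgebra and let $(s,t)=(\dim L_{\bar 0},\dim L_{\bar 1})$ be its superdimension. A defining pair of $L$ is a pair $(K,M)$ consisting of a Lie superalgebra $K$ and a graded ideal $M$ of $K$ with $K/M\cong L$ and $M\subseteq Z(K)\cap K^2$, where $Z(K)$ is the center and $K^2=[K,K]$. The multiplier $\mathcal{M}(L)$ is the ideal $M$ of a defining pair $(K,M)$ of $L$ for which the superdimension of $M$ is maximal (with respect to the componentwise order) among all defining pairs of $L$. The super-multiplier-rank of $L$ is $$\mathrm{smr}(L)=\Bigl(\tfrac12 s(s-1)+\tfrac12 t(t+1),\,st\Bigr)-\mathrm{sdim}\,\mathcal{M}(L)\in\mathbb{Z}\times\mathbb{Z}.$$ Let $H(1,0)$ be the Lie superalgebra of superdimension $(3,0)$ with even basis $u,v,z$, with $[u,v]=-[v,u]=z$, and with all other brackets of basis elements zero. Suppose that $L$ is finite-dimensional, nilpotent and non-abelian. Then (1) $\mathrm{smr}(L)\neq(0,1)$; (2) $\mathrm{smr}(L)=(1,0)$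 if and only if $L\cong H(1,0)$. -/

import Mathlib

universe u v w

/-- A Lie superalgebra structure on an `F`-vector space `L`: a decomposition of `L` into an even
part `part 0` and an odd part `part 1`, and a bilinear bracket which respects the parities, is
super-skew-symmetric and satisfies the super Jacobi identity. -/
class LieSuperalgebra (F : Type u) (L : Type v) [Field F] [AddCommGroup L] [Module F L] where
  part : ZMod 2 → Submodule F L
  isCompl : IsCompl (part 0) (part 1)
  bracket : L →ₗ[F] L →ₗ[F] L
  bracket_mem : ∀ (i j : ZMod 2) (x y : L), x ∈ part i → y ∈ part j →
    bracket x y ∈ part (i + j)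
  skew : ∀ (i j : ZMod 2) (x y : L), x ∈ part i → y ∈ part j →
    bracket x y = -((-1 : F) ^ (i.val * j.val) • bracket y x)
  jacobi : ∀ (i j : ZMod 2) (x y z : L), x ∈ part i → y ∈ part j →
    bracket x (bracket y z) =
      bracket (bracket x y) z + (-1 : F) ^ (i.val * j.val) • bracket y (bracket x z)

namespace LieSuperalgebra

section Basics

variable (F : Type u) [Field F]
variable (L : Type v) [AddCommGroup L] [Module F L] [LieSuperalgebra F L]

/-- `L` is abelian: the bracket vanishes. -/
def IsAbelian : Prop := ∀ x y : L, bracket (F := F) x y = 0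

/-- The center `Z(L) = {x | [x, L] = 0}`. -/
def center : Submodule F L := LinearMap.ker (bracket (F := F) (L := L))

/-- The derived subalgebra `L² = [L, L]`, the span of all brackets. -/
def derived : Submodule F L := Submodule.map₂ (bracket (F := F) (L := L)) ⊤ ⊤

/-- The lower central series: `L`, `[L, L]`, `[L, [L, L]]`, … (each term is a span of brackets). -/
def lowerCentral : ℕ → Submodule F L
  | 0 => ⊤
  | n + 1 => Submodule.map₂ (bracket (F := F) (L := L)) ⊤ (lowerCentral n)

/-- `L` is nilpotent: its lower central series reaches zero. -/
def IsNilpotent : Prop := ∃ n : ℕ, lowerCentral F L n = ⊥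

variable {F L}

/-- The superdimension `(dim W₀, dim W₁)` of a subsuperspace `W`. -/
noncomputable def sdim (W : Submodule F L) : ℕ × ℕ :=
  (Module.finrank F ↥(W ⊓ part 0), Module.finrank F ↥(W ⊓ part 1))

end Basics

section Hom

variable {F : Type u} [Field F]
variable {K : Type w} [AddCommGroup K] [Module F K] [LieSuperalgebra F K]
variable {L : Type v} [AddCommGroup L] [Module F L] [LieSuperalgebra F L]

/-- A linear map is a homomorphism of Lie superalgebras if it preserves parities and brackets. -/
def IsHom (f : K →ₗ[F] L) : Prop :=
  (∀ (i : ZMod 2) (x : K), x ∈ part (F := F) i → f x ∈ part (F := F) i) ∧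
    ∀ x y : K, f (bracket (F := F) x y) = bracket (F := F) (f x) (f y)

variable (L) in
/-- `(K, M)` is a defining pair of `L`: `K / M ≅ L` (that is, `M` is the kernel of a surjective
homomorphism `K → L`; in particular `M` is a graded ideal) and `M ⊆ Z(K) ∩ K²`. -/
def IsDefiningPair (M : Submodule F K) : Prop :=
  (∃ f : K →ₗ[F] L, IsHom f ∧ Function.Surjective f ∧ LinearMap.ker f = M) ∧
    M ≤ center F K ⊓ derived F K

variable (F K L) in
/-- Isomorphism of Lie superalgebras. -/
def Isomorphic : Prop := ∃ e : K ≃ₗ[F] L, IsHom (e : K →ₗ[F] L)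

end Hom

section Multiplier

variable (F : Type u) [Field F]
variable (L : Type v) [AddCommGroup L] [Module F L] [LieSuperalgebra F L]

/-- The superdimensions of the second members `M` of all the defining pairs `(K, M)` of `L`. -/
def definingSdims : Set (ℕ × ℕ) :=
  {d | ∃ (K : Type (max u v)) (_ : AddCommGroup K) (_ : Module F K) (_ : LieSuperalgebra F K)
    (M : Submodule F K), IsDefiningPair L M ∧ sdim M = d}

variable {F L}

theorem exists_parts (x : L) :
    ∃ a ∈ part (F := F) (L := L) 0, ∃ b ∈ part (F := F) (L := L) 1, a + b = x := by
  have h : x ∈ part (F := F) (L := L) 0 ⊔ part (F := F) (L := L) 1 := by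
    rw [(isCompl (F := F) (L := L)).sup_eq_top]; trivial
  exact Submodule.mem_sup.1 h

theorem eq_zero_of_add {a b : L} (ha : a ∈ part (F := F) (L := L) 0)
    (hb : b ∈ part (F := F) (L := L) 1) (h : a + b = 0) : a = 0 ∧ b = 0 := by
  have hab : a = -b := eq_neg_of_add_eq_zero_left h
  have ha0 : a = 0 := by
    apply (Submodule.disjoint_def.1 (isCompl (F := F) (L := L)).disjoint) a ha
    rw [hab]; exact Submodule.neg_mem _ hb
  exact ⟨ha0, by simpa [ha0] using h⟩

/-- Central elements are also annihilated by the bracket from the other side. -/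
theorem bracket_center {c : L} (hc : c ∈ center F L) (y : L) : bracket (F := F) y c = 0 := by
  obtain ⟨a, ha, b, hb, rfl⟩ := exists_parts (F := F) c
  have hc' : ∀ z : L, bracket (F := F) a z + bracket (F := F) b z = 0 := fun z => by
    have := congrArg (fun g : L →ₗ[F] L => g z) (LinearMap.mem_ker.1 hc)
    simpa using this
  obtain ⟨p, hp, q, hq, rfl⟩ := exists_parts (F := F) y
  have h1 := eq_zero_of_add (F := F) (by simpa using bracket_mem 0 0 a p ha hp)
    (by simpa using bracket_mem 1 0 b p hb hp) (hc' p)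
  have h2 := eq_zero_of_add (F := F) (bracket_mem 1 1 b q hb hq)
    (by simpa using bracket_mem 0 1 a q ha hq) (by rw [add_comm]; exact hc' q)
  have e1 := skew (F := F) 0 0 p a hp ha
  have e2 := skew (F := F) 0 1 p b hp hb
  have e3 := skew (F := F) 1 0 q a hq ha
  have e4 := skew (F := F) 1 1 q b hq hb
  rw [h1.1] at e1
  rw [h1.2] at e2
  rw [h2.2] at e3
  rw [h2.1] at e4
  simp only [smul_zero, neg_zero] at e1 e2 e3 e4
  simp [e1, e2, e3, e4]

/-- In a defining pair of a finite-dimensional `L` the derived subalgebra `K²` is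
finite-dimensional, with a bound depending on `dim L` only. -/
theorem IsDefiningPair.derived_le [FiniteDimensional F L]
    {K : Type w} [AddCommGroup K] [Module F K] [LieSuperalgebra F K] {M : Submodule F K}
    (h : IsDefiningPair L M) :
    FiniteDimensional F ↥(derived F K) ∧
      Module.finrank F ↥(derived F K) ≤ Module.finrank F L * Module.finrank F L := by
  obtain ⟨⟨f, -, hf, rfl⟩, hM⟩ := h
  obtain ⟨s, hs⟩ := LinearMap.exists_rightInverse_of_surjective f (LinearMap.range_eq_top.2 hf)
  have hs' : ∀ x, f (s x) = x := fun x => LinearMap.congr_fun hs x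
  let g : TensorProduct F L L →ₗ[F] K :=
    TensorProduct.lift ((bracket (F := F) (L := K)).compl₁₂ s s)
  have hg : derived F K ≤ LinearMap.range g := by
    refine Submodule.map₂_le.2 fun x _ y _ => ⟨f x ⊗ₜ[F] f y, ?_⟩
    have hc : ∀ x : K, x - s (f x) ∈ center F K := fun x =>
      (hM.trans inf_le_left) (by simp [LinearMap.mem_ker, hs'])
    have h1 : bracket (F := F) (x - s (f x)) y = 0 := by
      rw [LinearMap.mem_ker.1 (hc x)]; rfl
    have h2 := bracket_center (hc y) (s (f x))
    rw [map_sub, LinearMap.sub_apply, sub_eq_zero] at h1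
    rw [map_sub, sub_eq_zero] at h2
    simp only [g, TensorProduct.lift.tmul, LinearMap.compl₁₂_apply]
    rw [h1, h2]
  refine ⟨Submodule.finiteDimensional_of_le hg, (Submodule.finrank_mono hg).trans ?_⟩
  exact (LinearMap.finrank_range_le g).trans Module.finrank_tensorProduct.le

/-- Transport of a Lie superalgebra structure along a linear equivalence. -/
abbrev transport {K : Type w} [AddCommGroup K] [Module F K] (e : K ≃ₗ[F] L) :
    LieSuperalgebra F K where
  part i := (part i).comap (e : K →ₗ[F] L)
  isCompl := by
    have h := isCompl (F := F) (L := L)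
    refine ⟨Submodule.disjoint_def.2 fun x h0 h1 => ?_, codisjoint_iff.2 (eq_top_iff.2 ?_)⟩
    · exact e.map_eq_zero_iff.1 (Submodule.disjoint_def.1 h.disjoint (e x) h0 h1)
    · intro x _
      obtain ⟨a, ha, b, hb, hab⟩ := exists_parts (F := F) (e x)
      refine Submodule.mem_sup.2 ⟨e.symm a, by simpa using ha, e.symm b, by simpa using hb, ?_⟩
      rw [← map_add, hab, e.symm_apply_apply]
  bracket := ((bracket (F := F) (L := L)).compl₁₂ (e : K →ₗ[F] L) (e : K →ₗ[F] L)).compr₂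
    (e.symm : L →ₗ[F] K)
  bracket_mem i j x y hx hy := by simpa using bracket_mem i j (e x) (e y) hx hy
  skew i j x y hx hy := by
    simpa using congrArg e.symm (skew (F := F) i j (e x) (e y) hx hy)
  jacobi i j x y z hx hy := by
    simpa using congrArg e.symm (jacobi (F := F) i j (e x) (e y) (e z) hx hy)

variable (F L)

/-- The superdimensions of defining pairs of a finite-dimensional `L` have a maximal member
with respect to the componentwise order, so multipliers of `L` exist. -/
theorem exists_maximal_definingSdims [FiniteDimensional F L] :
    ∃ d : ℕ × ℕ, Maximal (fun d => d ∈ definingSdims F L) d := by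
  have hne : (definingSdims F L).Nonempty := by
    let e : ULift.{u, v} L ≃ₗ[F] L := ULift.moduleEquiv
    let _ : LieSuperalgebra F (ULift.{u, v} L) := transport e
    refine ⟨_, ULift.{u, v} L, inferInstance, inferInstance, inferInstance, ⊥,
      ⟨⟨(e : ULift.{u, v} L →ₗ[F] L), ⟨fun i x hx => hx, fun x y => ?_⟩, e.surjective,
        LinearMap.ker_eq_bot.2 e.injective⟩, bot_le⟩, rfl⟩
    exact e.apply_symm_apply _
  have hfin : (definingSdims F L).Finite := by
    refine (Set.finite_Iic ((Module.finrank F L * Module.finrank F L,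
      Module.finrank F L * Module.finrank F L) : ℕ × ℕ)).subset ?_
    rintro _ ⟨K, _, _, _, M, hM, rfl⟩
    obtain ⟨hfd, hle⟩ := hM.derived_le
    have hMd : M ≤ derived F K := hM.2.trans inf_le_right
    exact ⟨(Submodule.finrank_mono (inf_le_left.trans hMd)).trans hle,
      (Submodule.finrank_mono (inf_le_left.trans hMd)).trans hle⟩
  obtain ⟨d, hd⟩ := hfin.exists_maximal hne
  exact ⟨d, hd⟩

/-- The superdimension of the multiplier of `L`: the superdimension of `M` for a defining pair
`(K, M)` of `L` in which `M` is of maximal superdimension. -/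
noncomputable def sdimMultiplier [FiniteDimensional F L] : ℕ × ℕ :=
  (exists_maximal_definingSdims F L).choose

/-- The super-multiplier-rank of `L`; both divisions by two are exact. -/
noncomputable def smr [FiniteDimensional F L] : ℤ × ℤ :=
  let s : ℤ := (sdim (⊤ : Submodule F L)).1
  let t : ℤ := (sdim (⊤ : Submodule F L)).2
  (s * (s - 1) / 2 + t * (t + 1) / 2 - ((sdimMultiplier F L).1 : ℤ),
    s * t - ((sdimMultiplier F L).2 : ℤ))

end Multiplier

section Heisenberg

/-- The standard homogeneous basis of `H(p, q)`: the vectors `u₁, …, u_p, v₁, …, v_p, z` are even,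
the vectors `w₁, …, w_q` are odd. -/
inductive HeisenbergBasis (p q : ℕ) : Type
  | u (i : Fin p)
  | v (i : Fin p)
  | z
  | w (k : Fin q)
  deriving DecidableEq, Fintype

/-- The underlying space of `H(p, q)`: coordinate vectors in the standard basis. -/
abbrev Heisenberg (F : Type u) (p q : ℕ) : Type u := HeisenbergBasis p q → F

variable (F : Type u) [Field F] (p q : ℕ)

namespace Heisenberg

variable {F p q}

/-- The coefficient of `z` in a bracket, determined by `[uᵢ, vᵢ] = -[vᵢ, uᵢ] = z`,
`[wₖ, wₖ] = z`, all the other brackets of basis elements being zero. -/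
def form (x y : Heisenberg F p q) : F :=
  ∑ i, (x (.u i) * y (.v i) - x (.v i) * y (.u i)) + ∑ k, x (.w k) * y (.w k)

variable (F p q)

/-- The bracket of `H(p, q)`: `[x, y] = form x y • z`. -/
def heisenbergBracket : Heisenberg F p q →ₗ[F] Heisenberg F p q →ₗ[F] Heisenberg F p q :=
  LinearMap.mk₂ F (fun x y => form x y • Pi.single HeisenbergBasis.z 1)
    (fun x x' y => by
      rw [← add_smul]; congr 1
      simp only [form, Pi.add_apply, add_mul, Finset.sum_add_distrib, Finset.sum_sub_distrib]
      ring)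
    (fun c x y => by
      rw [smul_smul]; congr 1
      simp only [form, Pi.smul_apply, smul_eq_mul, mul_assoc, ← mul_sub, Finset.mul_sum, mul_add])
    (fun x y y' => by
      rw [← add_smul]; congr 1
      simp only [form, Pi.add_apply, mul_add, Finset.sum_add_distrib, Finset.sum_sub_distrib]
      ring)
    (fun c x y => by
      rw [smul_smul]; congr 1
      simp only [form, Pi.smul_apply, smul_eq_mul, mul_left_comm _ c, ← mul_sub, Finset.mul_sum,
        mul_add])

/-- The even part `span {uᵢ, vᵢ, z}` and the odd part `span {wₖ}`, through coordinates. -/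
def parity (i : ZMod 2) : Submodule F (Heisenberg F p q) where
  carrier := {x | if i = 0 then ∀ k, x (.w k) = 0
    else (∀ k, x (.u k) = 0) ∧ (∀ k, x (.v k) = 0) ∧ x .z = 0}
  add_mem' := by
    intro x y hx hy
    by_cases h : i = 0 <;> simp_all
  zero_mem' := by simp
  smul_mem' := by
    intro c x hx
    by_cases h : i = 0 <;> simp_all

variable {F p q}

theorem mem_parity_zero {x : Heisenberg F p q} :
    x ∈ parity F p q 0 ↔ ∀ k, x (.w k) = 0 := Iff.rfl

theorem mem_parity_one {x : Heisenberg F p q} :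
    x ∈ parity F p q 1 ↔ (∀ k, x (.u k) = 0) ∧ (∀ k, x (.v k) = 0) ∧ x .z = 0 := Iff.rfl

theorem bracket_apply (x y : Heisenberg F p q) :
    heisenbergBracket F p q x y = form x y • Pi.single HeisenbergBasis.z 1 := rfl

end Heisenberg

open Heisenberg in
/-- The Heisenberg Lie superalgebra `H(p, q)` of even center. -/
instance : LieSuperalgebra F (Heisenberg F p q) where
  part := parity F p q
  isCompl := by
    refine ⟨Submodule.disjoint_def.2 fun x h0 h1 => ?_, codisjoint_iff.2 (eq_top_iff.2 ?_)⟩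
    · rw [mem_parity_zero] at h0
      rw [mem_parity_one] at h1
      funext b
      cases b with
      | u i => exact h1.1 i
      | v i => exact h1.2.1 i
      | z => exact h1.2.2
      | w k => exact h0 k
    · intro x _
      let e : Heisenberg F p q := fun b => match b with
        | .w _ => 0
        | b => x b
      have he : ∀ k, e (.w k) = 0 := fun _ => rfl
      refine Submodule.mem_sup.2 ⟨e, mem_parity_zero.2 he, x - e, mem_parity_one.2 ?_, by abel⟩
      exact ⟨fun k => sub_self _, fun k => sub_self _, sub_self _⟩
  bracket := heisenbergBracket F p q
  bracket_mem := by
    intro i j x y hx hy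
    rw [bracket_apply]
    have hz : (Pi.single HeisenbergBasis.z 1 : Heisenberg F p q) ∈ parity F p q 0 := by
      rw [mem_parity_zero]; intro k; simp
    have key : i + j ≠ 0 → form x y = 0 := by
      fin_cases i <;> fin_cases j
      · exact fun h => absurd rfl h
      · have hx' := mem_parity_zero.1 hx
        have hy' := mem_parity_one.1 hy
        simp [form, hx', hy'.1, hy'.2.1]
      · have hx' := mem_parity_one.1 hx
        have hy' := mem_parity_zero.1 hy
        simp [form, hy', hx'.1, hx'.2.1]
      · exact fun h => absurd rfl h
    by_cases h : i + j = 0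
    · rw [h]; exact Submodule.smul_mem _ _ hz
    · rw [key h, zero_smul]; exact Submodule.zero_mem _
  skew := by
    intro i j x y hx hy
    have key : form x y = -((-1 : F) ^ (i.val * j.val) * form y x) := by
      have v0 : (0 : ZMod 2).val = 0 := rfl
      have v1 : (1 : ZMod 2).val = 1 := rfl
      fin_cases i <;> fin_cases j
      · have hx' := mem_parity_zero.1 hx
        change form x y = -((-1 : F) ^ ((0 : ZMod 2).val * (0 : ZMod 2).val) * form y x)
        simp [form, hx', v0, mul_comm]
      · have hx' := mem_parity_zero.1 hx
        have hy' := mem_parity_one.1 hy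
        simp [form, hx', hy'.1, hy'.2.1]
      · have hx' := mem_parity_one.1 hx
        have hy' := mem_parity_zero.1 hy
        simp [form, hy', hx'.1, hx'.2.1]
      · have hx' := mem_parity_one.1 hx
        have hy' := mem_parity_one.1 hy
        change form x y = -((-1 : F) ^ ((1 : ZMod 2).val * (1 : ZMod 2).val) * form y x)
        simp [form, hx'.1, hx'.2.1, v1, mul_comm]
    rw [bracket_apply, bracket_apply, key, neg_smul, smul_smul]
  jacobi := by
    intro i j x y t hx hy
    have h1 : ∀ (c : F) (x : Heisenberg F p q),
        form x (c • Pi.single HeisenbergBasis.z 1) = 0 := by intro c x; simp [form]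
    have h2 : ∀ (c : F) (x : Heisenberg F p q),
        form (c • Pi.single HeisenbergBasis.z 1) x = 0 := by intro c x; simp [form]
    simp only [bracket_apply, h1, h2, zero_smul, smul_zero, add_zero]

end Heisenberg

end LieSuperalgebra

/-! Let `(K, M)` be a defining pair realising the multiplier and let `Λ` be the super exterior
square of `L`, of superdimension `(s(s-1)/2 + t(t+1)/2, st)`. As `M` is central, the bracket of `K`
descends to a bilinear map `B` on `L × L` with values in `K`, and `K²` is spanned by the values of
`B` on a homogeneous basis, so `sdim K² ≤ sdim Λ`. As `M ≤ K²`, also `sdim K² = sdim M + sdim L²`.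
Hence `smr L = (sdim Λ - sdim K²) + sdim L²`, a sum of two nonnegative terms.

A small `smr` therefore makes `L²` small and `K²` as large as possible in a given parity. In the
second case the basis values of `B` in that parity are linearly independent, so every form of the
right symmetry factors through `B` (`exists_dual_even`, `exists_dual_odd`). The Jacobi identity of
`K`, read through `B`, then contradicts almost any nonzero bracket in `L`.

For `(0, 1)`, `L²` is purely odd and `K²` is maximal in even degree. If `z = [b, c] ≠ 0` with `b`
even and `c` odd, Jacobi on `b, c, c` gives `2 B(z, c) = 0`, which maximality forbids; so `L` is
abelian.

For `(1, 0)`, `L²` is an even line and `K²` is maximal in both degrees. Jacobi on `b, b, b` kills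
the brackets of odd elements, so some `z = [b, c] ≠ 0` has `b, c` even. Jacobi on `b, c, a` excludes
odd `a ≠ 0`, and then excludes `a` outside the span of `b, c, z`; nilpotency makes `z` central, so
`L` is `H(1, 0)`. Conversely, the free nilpotent Lie algebra of class three on two generators shows
that the bound `sdim M ≤ (2, 0)` for `H(1, 0)` is attained. -/

namespace LieSuperalgebra

/-! ### Homogeneous components of the derived subalgebra -/

section Graded

variable {F : Type u} [Field F]
variable {L : Type v} [AddCommGroup L] [Module F L] [LieSuperalgebra F L]

theorem mem_derived (x y : L) : bracket (F := F) x y ∈ derived F L :=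
  Submodule.apply_mem_map₂ _ trivial trivial

/-- The derived subalgebra is a graded subspace. -/
theorem derived_le_sup :
    derived F L ≤ (derived F L ⊓ part (F := F) 0) ⊔ (derived F L ⊓ part (F := F) 1) := by
  refine Submodule.map₂_le.2 fun x _ y _ => ?_
  obtain ⟨a, ha, b, hb, rfl⟩ := exists_parts (F := F) x
  obtain ⟨c, hc, d, hd, rfl⟩ := exists_parts (F := F) y
  simp only [map_add, LinearMap.add_apply]
  refine add_mem (add_mem ?_ ?_) (add_mem ?_ ?_)
  · exact Submodule.mem_sup_left ⟨mem_derived _ _, by simpa using bracket_mem 0 0 a c ha hc⟩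
  · exact Submodule.mem_sup_right ⟨mem_derived _ _, by simpa using bracket_mem 1 0 b c hb hc⟩
  · exact Submodule.mem_sup_right ⟨mem_derived _ _, by simpa using bracket_mem 0 1 a d ha hd⟩
  · exact Submodule.mem_sup_left ⟨mem_derived _ _, bracket_mem 1 1 b d hb hd⟩

theorem eq_of_mem_parts {a b a' b' : L} (ha : a ∈ part (F := F) (L := L) 0)
    (hb : b ∈ part (F := F) (L := L) 1) (ha' : a' ∈ part (F := F) (L := L) 0)
    (hb' : b' ∈ part (F := F) (L := L) 1) (h : a + b = a' + b') : a = a' ∧ b = b' := by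
  have := eq_zero_of_add (F := F) (sub_mem ha ha') (sub_mem hb hb')
    (by rw [sub_add_sub_comm, h, sub_self])
  exact ⟨sub_eq_zero.1 this.1, sub_eq_zero.1 this.2⟩

/-- If a graded subspace `S₀ ⊕ S₁` contains `W`, then `S₀` contains the even part of `W`. -/
theorem inf_part_zero_le {W S₀ S₁ : Submodule F L} (h : W ≤ S₀ ⊔ S₁)
    (h₀ : S₀ ≤ part (F := F) 0) (h₁ : S₁ ≤ part (F := F) 1) : W ⊓ part (F := F) 0 ≤ S₀ := by
  rintro x ⟨hx, hx0⟩
  obtain ⟨a, ha, b, hb, rfl⟩ := Submodule.mem_sup.1 (h hx)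
  have := eq_of_mem_parts (F := F) (h₀ ha) (h₁ hb) hx0 (zero_mem _) (by simp)
  rw [this.2, add_zero]
  exact ha

/-- If a graded subspace `S₀ ⊕ S₁` contains `W`, then `S₁` contains the odd part of `W`. -/
theorem inf_part_one_le {W S₀ S₁ : Submodule F L} (h : W ≤ S₀ ⊔ S₁)
    (h₀ : S₀ ≤ part (F := F) 0) (h₁ : S₁ ≤ part (F := F) 1) : W ⊓ part (F := F) 1 ≤ S₁ := by
  rintro x ⟨hx, hx1⟩
  obtain ⟨a, ha, b, hb, rfl⟩ := Submodule.mem_sup.1 (h hx)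
  have := eq_of_mem_parts (F := F) (h₀ ha) (h₁ hb) (zero_mem _) hx1 (by simp)
  rw [this.1, zero_add]
  exact hb

end Graded

/-! ### Defining pairs and the bracket they induce on `L` -/

section Pair

variable {F : Type u} [Field F]
variable {K : Type w} [AddCommGroup K] [Module F K] [LieSuperalgebra F K]
variable {L : Type v} [AddCommGroup L] [Module F L] [LieSuperalgebra F L]

theorem IsHom.map_derived {f : K →ₗ[F] L} (hf : IsHom f) (hs : Function.Surjective f) :
    (derived F K).map f = derived F L := by
  apply le_antisymm
  · rw [Submodule.map_le_iff_le_comap]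
    refine Submodule.map₂_le.2 fun x _ y _ => ?_
    rw [Submodule.mem_comap, hf.2]
    exact mem_derived _ _
  · refine Submodule.map₂_le.2 fun x _ y _ => ?_
    obtain ⟨x, rfl⟩ := hs x
    obtain ⟨y, rfl⟩ := hs y
    rw [← hf.2]
    exact Submodule.mem_map_of_mem (mem_derived _ _)

/-- The images of the two homogeneous parts of `K²` lie in the respective parts of `L²` and together
span it, so neither inclusion can be strict. -/
theorem IsHom.map_derived_inf_part {f : K →ₗ[F] L} (hf : IsHom f) (hs : Function.Surjective f) :
    (derived F K ⊓ part (F := F) 0).map f = derived F L ⊓ part (F := F) 0 ∧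
      (derived F K ⊓ part (F := F) 1).map f = derived F L ⊓ part (F := F) 1 := by
  have hle : ∀ i, (derived F K ⊓ part (F := F) i).map f ≤ derived F L ⊓ part (F := F) i := by
    rintro i _ ⟨x, ⟨hx, hxi⟩, rfl⟩
    exact ⟨hf.map_derived hs ▸ Submodule.mem_map_of_mem hx, hf.1 i x hxi⟩
  have hsup : derived F L ≤ (derived F K ⊓ part (F := F) 0).map f ⊔
      (derived F K ⊓ part (F := F) 1).map f := by
    rw [← Submodule.map_sup, ← hf.map_derived hs]
    exact Submodule.map_mono derived_le_sup
  exact ⟨le_antisymm (hle 0) (inf_part_zero_le hsup ((hle 0).trans inf_le_right)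
      ((hle 1).trans inf_le_right)),
    le_antisymm (hle 1) (inf_part_one_le hsup ((hle 0).trans inf_le_right)
      ((hle 1).trans inf_le_right))⟩

theorem IsHom.exists_lift {f : K →ₗ[F] L} (hf : IsHom f) (hs : Function.Surjective f)
    (i : ZMod 2) {x : L} (hx : x ∈ part (F := F) i) : ∃ k ∈ part (F := F) (L := K) i, f k = x := by
  obtain ⟨k, rfl⟩ := hs x
  obtain ⟨a, ha, b, hb, rfl⟩ := exists_parts (F := F) k
  rw [map_add] at hx ⊢
  fin_cases i
  · have := eq_of_mem_parts (F := F) (hf.1 0 a ha) (hf.1 1 b hb) hx (zero_mem _) (by simp)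
    exact ⟨a, ha, this.1⟩
  · have := eq_of_mem_parts (F := F) (hf.1 0 a ha) (hf.1 1 b hb) (zero_mem _) hx (by simp)
    exact ⟨b, hb, this.2⟩

theorem finrank_inf_ker_add_finrank_map {V W : Type*} [AddCommGroup V] [Module F V]
    [AddCommGroup W] [Module F W] (f : V →ₗ[F] W) (P : Submodule F V) [FiniteDimensional F P] :
    Module.finrank F ↥(LinearMap.ker f ⊓ P) + Module.finrank F ↥(P.map f) =
      Module.finrank F P := by
  have h := (f.domRestrict P).finrank_range_add_finrank_ker
  have h2 : Module.finrank F ↥(LinearMap.ker (f.domRestrict P)) =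
      Module.finrank F ↥(LinearMap.ker f ⊓ P) := by
    rw [← Submodule.finrank_map_subtype_eq P (LinearMap.ker (f.domRestrict P))]
    have : (LinearMap.ker (f.domRestrict P)).map P.subtype = LinearMap.ker f ⊓ P := by
      ext x
      simp [LinearMap.mem_ker, and_comm]
    rw [this]
  rw [LinearMap.range_domRestrict] at h
  omega

/-- The superdimension of `K²` is the sum of those of `M` and `L²`. -/
theorem IsDefiningPair.sdim_add [FiniteDimensional F L] {M : Submodule F K}
    (h : IsDefiningPair L M) : sdim M + sdim (derived F L) = sdim (derived F K) := by
  have hfd := h.derived_le.1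
  obtain ⟨⟨f, hf, hs, rfl⟩, hM⟩ := h
  -- Since `M ≤ K²`, rank-nullity on each homogeneous part of `K²` sees all of the corresponding
  -- part of `M`.
  have key : ∀ i, LinearMap.ker f ⊓ (derived F K ⊓ part (F := F) i) =
      LinearMap.ker f ⊓ part (F := F) i := fun i => by
    rw [← inf_assoc, inf_eq_left.2 (hM.trans inf_le_right)]
  have : ∀ i, FiniteDimensional F ↥(derived F K ⊓ part (F := F) i) := fun i =>
    Submodule.finiteDimensional_of_le inf_le_left
  have h0 := finrank_inf_ker_add_finrank_map f (derived F K ⊓ part (F := F) 0)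
  have h1 := finrank_inf_ker_add_finrank_map f (derived F K ⊓ part (F := F) 1)
  rw [key, (hf.map_derived_inf_part hs).1] at h0
  rw [key, (hf.map_derived_inf_part hs).2] at h1
  exact Prod.ext h0 h1

/-- The bracket of `K` in a defining pair `(K, M)` of `L` is induced by a super-skew-symmetric
bilinear map on `L` which satisfies a cocycle identity. -/
structure IsBracketLift (f : K →ₗ[F] L) (B : L →ₗ[F] L →ₗ[F] K) : Prop where
  bracket_eq (x y : K) : bracket (F := F) x y = B (f x) (f y)
  mem (i j : ZMod 2) (x y : L) (hx : x ∈ part (F := F) i) (hy : y ∈ part (F := F) j) :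
    B x y ∈ part (F := F) (i + j)
  skew (i j : ZMod 2) (x y : L) (hx : x ∈ part (F := F) i) (hy : y ∈ part (F := F) j) :
    B x y = -((-1 : F) ^ (i.val * j.val) • B y x)
  jacobi (i j : ZMod 2) (x y z : L) (hx : x ∈ part (F := F) i) (hy : y ∈ part (F := F) j) :
    B x (bracket (F := F) y z) = B (bracket (F := F) x y) z +
      (-1 : F) ^ (i.val * j.val) • B y (bracket (F := F) x z)

/-- Changing a lift by a central element does not change brackets, so any linear section computes
`B`. The section need not respect parity: the graded identities are checked on homogeneous lifts
instead. -/
theorem IsHom.exists_isBracketLift {f : K →ₗ[F] L} (hf : IsHom f) (hs : Function.Surjective f)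
    (hker : LinearMap.ker f ≤ center F K) : ∃ B : L →ₗ[F] L →ₗ[F] K, IsBracketLift f B := by
  obtain ⟨s, hs'⟩ := LinearMap.exists_rightInverse_of_surjective f (LinearMap.range_eq_top.2 hs)
  replace hs' : ∀ x, f (s x) = x := fun x => LinearMap.congr_fun hs' x
  have hB : ∀ x y : K, bracket (F := F) x y =
      (bracket (F := F) (L := K)).compl₁₂ s s (f x) (f y) := by
    intro x y
    have hc : ∀ x : K, x - s (f x) ∈ center F K := fun x =>
      hker (by simp [LinearMap.mem_ker, hs'])
    have h1 : bracket (F := F) (x - s (f x)) y = 0 := by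
      rw [LinearMap.mem_ker.1 (hc x)]; rfl
    have h2 := bracket_center (hc y) (s (f x))
    rw [map_sub, LinearMap.sub_apply, sub_eq_zero] at h1
    rw [map_sub, sub_eq_zero] at h2
    rw [h1, h2, LinearMap.compl₁₂_apply]
  refine ⟨_, hB, fun i j x y hx hy => ?_, fun i j x y hx hy => ?_, fun i j x y z hx hy => ?_⟩
  all_goals
    obtain ⟨x, hx', rfl⟩ := hf.exists_lift hs _ hx
    obtain ⟨y, hy', rfl⟩ := hf.exists_lift hs _ hy
  · rw [← hB]
    exact bracket_mem _ _ _ _ hx' hy'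
  · rw [← hB, ← hB]
    exact LieSuperalgebra.skew _ _ _ _ hx' hy'
  · obtain ⟨z, rfl⟩ := hs z
    simp only [← hf.2, ← hB]
    exact LieSuperalgebra.jacobi _ _ _ _ _ hx' hy'

theorem IsBracketLift.derived_eq {f : K →ₗ[F] L} {B : L →ₗ[F] L →ₗ[F] K}
    (hB : IsBracketLift f B) (hs : Function.Surjective f) :
    derived F K = Submodule.map₂ B ⊤ ⊤ := by
  apply le_antisymm
  · refine Submodule.map₂_le.2 fun x _ y _ => ?_
    rw [hB.bracket_eq]
    exact Submodule.apply_mem_map₂ _ trivial trivial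
  · refine Submodule.map₂_le.2 fun x _ y _ => ?_
    obtain ⟨x, rfl⟩ := hs x
    obtain ⟨y, rfl⟩ := hs y
    rw [← hB.bracket_eq]
    exact mem_derived _ _

/-! ### Spanning `K²` by brackets of basis elements -/

section Span

variable {ι κ : Type*} [LinearOrder ι] [LinearOrder κ]

/-- The even brackets of basis elements, one for each unordered pair. -/
def evenBrackets (B : L →ₗ[F] L →ₗ[F] K) (e : ι → L) (o : κ → L) :
    {p : ι × ι // p.1 < p.2} ⊕ {p : κ × κ // p.1 ≤ p.2} → K :=
  Sum.elim (fun p => B (e p.1.1) (e p.1.2)) (fun p => B (o p.1.1) (o p.1.2))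

/-- The odd brackets of basis elements. -/
def oddBrackets (B : L →ₗ[F] L →ₗ[F] K) (e : ι → L) (o : κ → L) : ι × κ → K :=
  fun p => B (e p.1) (o p.2)

theorem map₂_le_of_span {V W X : Type*} [AddCommGroup V] [Module F V] [AddCommGroup W]
    [Module F W] [AddCommGroup X] [Module F X] (B : V →ₗ[F] W →ₗ[F] X) {ι κ : Type*}
    {e : ι → V} {o : κ → W} {S : Submodule F X} (h : ∀ i j, B (e i) (o j) ∈ S) {x : V} {y : W}
    (hx : x ∈ Submodule.span F (Set.range e)) (hy : y ∈ Submodule.span F (Set.range o)) :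
    B x y ∈ S := by
  have h1 := Submodule.apply_mem_map₂ B hx hy
  rw [Submodule.map₂_span_span] at h1
  refine Submodule.span_le.2 ?_ h1
  rintro _ ⟨_, ⟨i, rfl⟩, _, ⟨j, rfl⟩, rfl⟩
  exact h i j

variable [CharZero F]

theorem IsBracketLift.even_self {f : K →ₗ[F] L} {B : L →ₗ[F] L →ₗ[F] K}
    (hB : IsBracketLift f B) {x : L} (hx : x ∈ part (F := F) 0) : B x x = 0 := by
  have := hB.skew 0 0 x x hx hx
  simp only [ZMod.val_zero, mul_zero, pow_zero, one_smul] at this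
  have h2 : (2 : F) • B x x = 0 := by
    rw [two_smul]
    nth_rewrite 1 [this]
    simp
  exact (smul_eq_zero.1 h2).resolve_left two_ne_zero

/-- Super-skew-symmetry allows one representative per unordered pair, without the diagonal for even
elements and with it for odd ones. Both spans are homogeneous, so the two parities separate. -/
theorem IsBracketLift.derived_le_span {f : K →ₗ[F] L} {B : L →ₗ[F] L →ₗ[F] K}
    (hB : IsBracketLift f B) (hs : Function.Surjective f) {e : ι → L} {o : κ → L}
    (he : Submodule.span F (Set.range e) = part (F := F) 0)
    (ho : Submodule.span F (Set.range o) = part (F := F) 1) :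
    derived F K ⊓ part (F := F) 0 ≤ Submodule.span F (Set.range (evenBrackets B e o)) ∧
      derived F K ⊓ part (F := F) 1 ≤ Submodule.span F (Set.range (oddBrackets B e o)) := by
  have he' : ∀ i, e i ∈ part (F := F) (L := L) 0 := fun i => he ▸ Submodule.subset_span ⟨i, rfl⟩
  have ho' : ∀ i, o i ∈ part (F := F) (L := L) 1 := fun i => ho ▸ Submodule.subset_span ⟨i, rfl⟩
  have hee : ∀ i j, B (e i) (e j) ∈ Submodule.span F (Set.range (evenBrackets B e o)) := by
    have key : ∀ i j, i < j →
        B (e i) (e j) ∈ Submodule.span F (Set.range (evenBrackets B e o)) :=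
      fun i j h => Submodule.subset_span ⟨Sum.inl ⟨(i, j), h⟩, rfl⟩
    intro i j
    rcases lt_trichotomy i j with h | rfl | h
    · exact key i j h
    · rw [hB.even_self (he' i)]; exact zero_mem _
    · rw [hB.skew 0 0 _ _ (he' i) (he' j)]
      exact neg_mem (Submodule.smul_mem _ _ (key j i h))
  have hoo : ∀ i j, B (o i) (o j) ∈ Submodule.span F (Set.range (evenBrackets B e o)) := by
    have key : ∀ i j, i ≤ j →
        B (o i) (o j) ∈ Submodule.span F (Set.range (evenBrackets B e o)) :=
      fun i j h => Submodule.subset_span ⟨Sum.inr ⟨(i, j), h⟩, rfl⟩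
    intro i j
    rcases le_total i j with h | h
    · exact key i j h
    · rw [hB.skew 1 1 _ _ (ho' i) (ho' j)]
      exact neg_mem (Submodule.smul_mem _ _ (key j i h))
  have heo : ∀ i j, B (e i) (o j) ∈ Submodule.span F (Set.range (oddBrackets B e o)) :=
    fun i j => Submodule.subset_span ⟨(i, j), rfl⟩
  have hoe : ∀ i j, B (o i) (e j) ∈ Submodule.span F (Set.range (oddBrackets B e o)) := by
    intro i j
    rw [hB.skew 1 0 _ _ (ho' i) (he' j)]
    exact neg_mem (Submodule.smul_mem _ _ (heo j i))
  have hsup : derived F K ≤ Submodule.span F (Set.range (evenBrackets B e o)) ⊔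
      Submodule.span F (Set.range (oddBrackets B e o)) := by
    rw [hB.derived_eq hs]
    refine Submodule.map₂_le.2 fun x _ y _ => ?_
    obtain ⟨a, ha, b, hb, rfl⟩ := exists_parts (F := F) x
    obtain ⟨c, hc, d, hd, rfl⟩ := exists_parts (F := F) y
    rw [← he] at ha hc
    rw [← ho] at hb hd
    simp only [map_add, LinearMap.add_apply]
    exact add_mem
      (add_mem (Submodule.mem_sup_left (map₂_le_of_span B hee ha hc))
        (Submodule.mem_sup_right (map₂_le_of_span B hoe hb hc)))
      (add_mem (Submodule.mem_sup_right (map₂_le_of_span B heo ha hd))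
        (Submodule.mem_sup_left (map₂_le_of_span B hoo hb hd)))
  have h0 : Submodule.span F (Set.range (evenBrackets B e o)) ≤ part (F := F) 0 := by
    rw [Submodule.span_le]
    rintro _ ⟨p | p, rfl⟩
    · simpa [evenBrackets] using hB.mem 0 0 _ _ (he' p.1.1) (he' p.1.2)
    · exact hB.mem 1 1 _ _ (ho' p.1.1) (ho' p.1.2)
  have h1 : Submodule.span F (Set.range (oddBrackets B e o)) ≤ part (F := F) 1 := by
    rw [Submodule.span_le]
    rintro _ ⟨p, rfl⟩
    simpa [oddBrackets] using hB.mem 0 1 _ _ (he' p.1) (ho' p.2)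
  exact ⟨inf_part_zero_le hsup h0 h1, inf_part_one_le hsup h0 h1⟩

end Span

end Pair

/-! ### Counting pairs, and functionals with prescribed values -/

theorem card_lt_pairs (n : ℕ) :
    Fintype.card {p : Fin n × Fin n // p.1 < p.2} = n * (n - 1) / 2 := by
  rw [Fintype.card_subtype, Finset.card_filter, Fintype.sum_prod_type_right]
  simp only [← Finset.card_filter, Finset.filter_gt_eq_Iio, Fin.card_Iio]
  rw [Fin.sum_univ_eq_sum_range (fun i => i), Finset.sum_range_id]

theorem card_le_pairs (n : ℕ) :
    Fintype.card {p : Fin n × Fin n // p.1 ≤ p.2} = n * (n + 1) / 2 := by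
  rw [Fintype.card_subtype, Finset.card_filter, Fintype.sum_prod_type_right]
  simp only [← Finset.card_filter, Finset.filter_ge_eq_Iic, Fin.card_Iic]
  have h := Finset.sum_range_succ' (fun i => i) n
  rw [Finset.sum_range_id, add_zero, Nat.add_sub_cancel, mul_comm] at h
  rw [Fin.sum_univ_eq_sum_range (fun i => i + 1), h]

/-- A spanning family with no more members than the dimension takes arbitrary values under
a linear functional. -/
theorem exists_dual_apply_eq {F V ι : Type*} [Field F] [AddCommGroup V] [Module F V] [Fintype ι]
    {P : Submodule F V} {b : ι → V} (h : P ≤ Submodule.span F (Set.range b))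
    (hcard : Fintype.card ι ≤ Module.finrank F P) (c : ι → F) :
    ∃ φ : V →ₗ[F] F, ∀ i, φ (b i) = c i := by
  have : FiniteDimensional F ↥(Submodule.span F (Set.range b)) :=
    FiniteDimensional.span_of_finite F (Set.finite_range b)
  -- The span of `b` has dimension at least that of `P`, hence at least the number of vectors, so
  -- `b` is a basis of its span.
  have hli : LinearIndependent F b := by
    rw [linearIndependent_iff_card_le_finrank_span]
    exact hcard.trans (Submodule.finrank_mono h)
  obtain ⟨φ, hφ⟩ := LinearMap.exists_extend ((Module.Basis.span hli).constr F c)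
  refine ⟨φ, fun i => ?_⟩
  have := LinearMap.congr_fun hφ (Module.Basis.span hli i)
  rw [Module.Basis.constr_basis] at this
  rw [← this]
  simp [Module.Basis.span_apply]

end LieSuperalgebra

namespace LieSuperalgebra

theorem exists_fin_span_eq {F V : Type*} [Field F] [AddCommGroup V] [Module F V]
    (P : Submodule F V) [FiniteDimensional F P] :
    ∃ e : Fin (Module.finrank F P) → V, Submodule.span F (Set.range e) = P := by
  refine ⟨fun i => Module.finBasis F P i, ?_⟩
  have h := congrArg (Submodule.map P.subtype) (Module.finBasis F P).span_eq
  rw [Submodule.map_span, ← Set.range_comp, Submodule.map_top, Submodule.range_subtype] at h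
  exact h

/-- One functional for both vectors: the square `ζ ⊗ ζ` is then a symmetric form that is nonzero at
`(x, y)`. -/
theorem exists_dual_ne_zero {F V : Type*} [Field F] [AddCommGroup V] [Module F V]
    {x y : V} (hx : x ≠ 0) (hy : y ≠ 0) : ∃ ζ : V →ₗ[F] F, ζ x ≠ 0 ∧ ζ y ≠ 0 := by
  obtain ⟨α, hα⟩ := not_forall.1 (mt (Module.forall_dual_apply_eq_zero_iff F x).1 hx)
  obtain ⟨β, hβ⟩ := not_forall.1 (mt (Module.forall_dual_apply_eq_zero_iff F y).1 hy)
  by_cases h1 : α y = 0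
  · by_cases h2 : β x = 0
    · exact ⟨α + β, by simpa [h2] using hα, by simpa [h1] using hβ⟩
    · exact ⟨β, h2, hβ⟩
  · exact ⟨α, hα, h1⟩

/-! ### Criteria for vanishing and the exterior square -/

section Parts

variable {F : Type u} [Field F]
variable {L : Type v} [AddCommGroup L] [Module F L] [LieSuperalgebra F L]

theorem eq_zero_of_mem_derived_zero [FiniteDimensional F L] (h : (sdim (derived F L)).1 = 0) {x : L}
    (hx : x ∈ derived F L) (hx0 : x ∈ part (F := F) 0) : x = 0 := by
  have := Submodule.finrank_eq_zero.1 h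
  exact (Submodule.mem_bot F).1 (this ▸ ⟨hx, hx0⟩)

theorem eq_zero_of_mem_derived_one [FiniteDimensional F L] (h : (sdim (derived F L)).2 = 0) {x : L}
    (hx : x ∈ derived F L) (hx0 : x ∈ part (F := F) 1) : x = 0 := by
  have := Submodule.finrank_eq_zero.1 h
  exact (Submodule.mem_bot F).1 (this ▸ ⟨hx, hx0⟩)

theorem isAbelian_of_parts
    (h00 : ∀ x ∈ part (F := F) (L := L) 0, ∀ y ∈ part (F := F) (L := L) 0,
      bracket (F := F) x y = 0)
    (h01 : ∀ x ∈ part (F := F) (L := L) 0, ∀ y ∈ part (F := F) (L := L) 1,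
      bracket (F := F) x y = 0)
    (h11 : ∀ x ∈ part (F := F) (L := L) 1, ∀ y ∈ part (F := F) (L := L) 1,
      bracket (F := F) x y = 0) : IsAbelian F L := by
  intro x y
  obtain ⟨a, ha, b, hb, rfl⟩ := exists_parts (F := F) x
  obtain ⟨c, hc, d, hd, rfl⟩ := exists_parts (F := F) y
  simp [h00 a ha c hc, h01 a ha d hd, h11 b hb d hd, skew (F := F) 1 0 b c hb hc, h01 c hc b hb]

theorem sdim_top : sdim (⊤ : Submodule F L) =
    (Module.finrank F ↥(part (F := F) (L := L) 0),
      Module.finrank F ↥(part (F := F) (L := L) 1)) := by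
  rw [sdim, top_inf_eq, top_inf_eq]

variable (F L) in
/-- The superdimension of the super exterior square of `L`. -/
noncomputable def sdimExteriorSquare : ℕ × ℕ :=
  ((sdim (⊤ : Submodule F L)).1 * ((sdim (⊤ : Submodule F L)).1 - 1) / 2 +
    (sdim (⊤ : Submodule F L)).2 * ((sdim (⊤ : Submodule F L)).2 + 1) / 2,
    (sdim (⊤ : Submodule F L)).1 * (sdim (⊤ : Submodule F L)).2)

end Parts

/-! ### The upper bound for `K²` and consequences of attaining it -/

section Bounds

variable {F : Type u} [Field F] [CharZero F]
variable {K : Type w} [AddCommGroup K] [Module F K] [LieSuperalgebra F K]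
variable {L : Type v} [AddCommGroup L] [Module F L] [LieSuperalgebra F L]

variable [FiniteDimensional F L] {f : K →ₗ[F] L} {B : L →ₗ[F] L →ₗ[F] K}

theorem IsBracketLift.sdim_derived_le (hB : IsBracketLift f B) (hs : Function.Surjective f) :
    sdim (derived F K) ≤ sdimExteriorSquare F L := by
  obtain ⟨e, he⟩ := exists_fin_span_eq (part (F := F) (L := L) 0)
  obtain ⟨o, ho⟩ := exists_fin_span_eq (part (F := F) (L := L) 1)
  obtain ⟨h0, h1⟩ := hB.derived_le_span hs he ho
  have : FiniteDimensional F ↥(Submodule.span F (Set.range (evenBrackets B e o))) :=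
    FiniteDimensional.span_of_finite F (Set.finite_range _)
  have : FiniteDimensional F ↥(Submodule.span F (Set.range (oddBrackets B e o))) :=
    FiniteDimensional.span_of_finite F (Set.finite_range _)
  constructor
  · refine (Submodule.finrank_mono h0).trans ((finrank_range_le_card _).trans ?_)
    rw [Fintype.card_sum, card_lt_pairs, card_le_pairs]
    simp only [sdimExteriorSquare, sdim_top, le_refl]
  · refine (Submodule.finrank_mono h1).trans ((finrank_range_le_card _).trans ?_)
    simp [sdimExteriorSquare, sdim_top]

/-- If the even part of `K²` has the largest possible dimension, every pair of an alternating
form on `L₀` and a symmetric form on `L₁` factors through the bracket of `K`. -/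
theorem IsBracketLift.exists_dual_even (hB : IsBracketLift f B) (hs : Function.Surjective f)
    (hcard : (sdimExteriorSquare F L).1 ≤ (sdim (derived F K)).1) (ω σ : L →ₗ[F] L →ₗ[F] F)
    (hω : ∀ x, ω x x = 0) (hσ : ∀ x y, σ x y = σ y x) :
    ∃ φ : K →ₗ[F] F,
      (∀ x ∈ part (F := F) (L := L) 0, ∀ y ∈ part (F := F) (L := L) 0, φ (B x y) = ω x y) ∧
      ∀ x ∈ part (F := F) (L := L) 1, ∀ y ∈ part (F := F) (L := L) 1, φ (B x y) = σ x y := by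
  obtain ⟨e, he⟩ := exists_fin_span_eq (part (F := F) (L := L) 0)
  obtain ⟨o, ho⟩ := exists_fin_span_eq (part (F := F) (L := L) 1)
  have he' : ∀ i, e i ∈ part (F := F) (L := L) 0 := fun i => he ▸ Submodule.subset_span ⟨i, rfl⟩
  have ho' : ∀ i, o i ∈ part (F := F) (L := L) 1 := fun i => ho ▸ Submodule.subset_span ⟨i, rfl⟩
  obtain ⟨φ, hφ⟩ := exists_dual_apply_eq (hB.derived_le_span hs he ho).1 (by
      rw [Fintype.card_sum, card_lt_pairs, card_le_pairs]
      refine le_trans (le_of_eq ?_) hcard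
      simp only [sdimExteriorSquare, sdim_top])
    (Sum.elim (fun p => ω (e p.1.1) (e p.1.2)) (fun p => σ (o p.1.1) (o p.1.2)))
  have he2 : ∀ i j, i < j → φ (B (e i) (e j)) = ω (e i) (e j) :=
    fun i j h => hφ (Sum.inl ⟨(i, j), h⟩)
  have ho2 : ∀ i j, i ≤ j → φ (B (o i) (o j)) = σ (o i) (o j) :=
    fun i j h => hφ (Sum.inr ⟨(i, j), h⟩)
  refine ⟨φ, fun x hx y hy => ?_, fun x hx y hy => ?_⟩
  · rw [← he] at hx hy
    -- With `S = ⊥` this says that a bilinear map vanishing on spanning vectors vanishes; it is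
    -- applied to the difference of the two forms.
    have := map₂_le_of_span (S := ⊥) (B.compr₂ φ - ω) (fun i j => ?_) hx hy
    · simpa [sub_eq_zero] using this
    · suffices φ (B (e i) (e j)) = ω (e i) (e j) by simp [this]
      rcases lt_trichotomy i j with h | rfl | h
      · exact he2 i j h
      · rw [hB.even_self (he' i), hω, map_zero]
      · rw [hB.skew 0 0 _ _ (he' i) (he' j)]
        have := hω (e i + e j)
        simp only [map_add, LinearMap.add_apply, hω, zero_add, add_zero] at this
        simp [he2 j i h, eq_neg_of_add_eq_zero_left this]
  · rw [← ho] at hx hy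
    have := map₂_le_of_span (S := ⊥) (B.compr₂ φ - σ) (fun i j => ?_) hx hy
    · simpa [sub_eq_zero] using this
    · suffices φ (B (o i) (o j)) = σ (o i) (o j) by simp [this]
      rcases le_total i j with h | h
      · exact ho2 i j h
      · rw [hB.skew 1 1 _ _ (ho' i) (ho' j), hσ]
        simp [ho2 j i h, ZMod.val_one]

/-- If the odd part of `K²` has the largest possible dimension, every bilinear form on
`L₀ × L₁` factors through the bracket of `K`. -/
theorem IsBracketLift.exists_dual_odd (hB : IsBracketLift f B) (hs : Function.Surjective f)
    (hcard : (sdimExteriorSquare F L).2 ≤ (sdim (derived F K)).2) (β : L →ₗ[F] L →ₗ[F] F) :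
    ∃ φ : K →ₗ[F] F, ∀ x ∈ part (F := F) (L := L) 0, ∀ y ∈ part (F := F) (L := L) 1,
      φ (B x y) = β x y := by
  obtain ⟨e, he⟩ := exists_fin_span_eq (part (F := F) (L := L) 0)
  obtain ⟨o, ho⟩ := exists_fin_span_eq (part (F := F) (L := L) 1)
  obtain ⟨φ, hφ⟩ := exists_dual_apply_eq (hB.derived_le_span hs he ho).2 (by
      refine le_trans (le_of_eq ?_) hcard
      simp [sdimExteriorSquare, sdim_top])
    (fun p => β (e p.1) (o p.2))
  refine ⟨φ, fun x hx y hy => ?_⟩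
  rw [← he] at hx
  rw [← ho] at hy
  have := map₂_le_of_span (S := ⊥) (B.compr₂ φ - β) (fun i j => ?_) hx hy
  · simpa [sub_eq_zero] using this
  · have : φ (B (e i) (o j)) = β (e i) (o j) := hφ (i, j)
    simp [this]

/-- Some functional takes the value `ζ x * ζ y ≠ 0` at `B x y`. -/
theorem IsBracketLift.ne_zero_of_even_odd (hB : IsBracketLift f B) (hs : Function.Surjective f)
    (hcard : (sdimExteriorSquare F L).2 ≤ (sdim (derived F K)).2) {x y : L}
    (hx : x ∈ part (F := F) 0) (hy : y ∈ part (F := F) 1) (hx0 : x ≠ 0) (hy0 : y ≠ 0) :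
    B x y ≠ 0 := by
  obtain ⟨ζ, hζx, hζy⟩ := exists_dual_ne_zero (F := F) hx0 hy0
  obtain ⟨φ, hφ⟩ := hB.exists_dual_odd hs hcard ((LinearMap.mul F F).compl₁₂ ζ ζ)
  intro h
  have := hφ x hx y hy
  rw [h, map_zero] at this
  simp [hζx, hζy] at this

theorem IsBracketLift.ne_zero_of_odd_odd (hB : IsBracketLift f B) (hs : Function.Surjective f)
    (hcard : (sdimExteriorSquare F L).1 ≤ (sdim (derived F K)).1) {x y : L}
    (hx : x ∈ part (F := F) 1) (hy : y ∈ part (F := F) 1) (hx0 : x ≠ 0) (hy0 : y ≠ 0) :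
    B x y ≠ 0 := by
  obtain ⟨ζ, hζx, hζy⟩ := exists_dual_ne_zero (F := F) hx0 hy0
  obtain ⟨φ, -, hφ⟩ := hB.exists_dual_even hs hcard 0 ((LinearMap.mul F F).compl₁₂ ζ ζ)
    (fun _ => rfl) (fun x y => by simp [mul_comm])
  intro h
  have := hφ x hx y hy
  rw [h, map_zero] at this
  simp [hζx, hζy] at this

/-- The even part of `K²` cannot have the largest possible dimension if `[L, L]` is odd. -/
theorem IsBracketLift.isAbelian_of_derived_odd (hB : IsBracketLift f B)
    (hs : Function.Surjective f)
    (hcard : (sdimExteriorSquare F L).1 ≤ (sdim (derived F K)).1)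
    (h0 : (sdim (derived F L)).1 = 0) : IsAbelian F L := by
  have h11 : ∀ x ∈ part (F := F) (L := L) 1, ∀ y ∈ part (F := F) (L := L) 1,
      bracket (F := F) x y = 0 := fun x hx y hy =>
    eq_zero_of_mem_derived_zero h0 (mem_derived _ _) (bracket_mem 1 1 _ _ hx hy)
  refine isAbelian_of_parts (fun x hx y hy => eq_zero_of_mem_derived_zero h0 (mem_derived _ _)
    (by simpa using bracket_mem 0 0 _ _ hx hy)) (fun b hb c hc => ?_) h11
  by_contra hz
  have hz1 : bracket (F := F) b c ∈ part (F := F) 1 := by simpa using bracket_mem 0 1 _ _ hb hc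
  -- With `z = [b, c]` and `[c, c] = 0` this reads `0 = B(z, c) + B(c, z)`; both `z` and `c` are
  -- odd, so `B` is symmetric on them and `2 B(z, c) = 0`.
  have hj := hB.jacobi 0 1 b c c hb hc
  rw [h11 c hc c hc, map_zero, hB.skew 1 1 _ _ hc hz1] at hj
  have hj' : (2 : F) • B (bracket (F := F) b c) c = 0 := by
    rw [two_smul]
    simpa [ZMod.val_one] using hj.symm
  have hc0 : c ≠ 0 := by rintro rfl; simp at hz
  exact hB.ne_zero_of_odd_odd hs hcard hz1 hc hz hc0 ((smul_eq_zero.1 hj').resolve_left two_ne_zero)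

end Bounds

end LieSuperalgebra

namespace LieSuperalgebra

/-! ### Recognising `H(1, 0)` -/

section Recognition

variable {F : Type u} [Field F]
variable {L : Type v} [AddCommGroup L] [Module F L] [LieSuperalgebra F L]

/-- If `c ≠ 0`, then `z = [c⁻¹ x, z]`, so `z` survives in every term of the lower central series. -/
theorem IsNilpotent.eq_zero_of_bracket_eq_smul (hnil : IsNilpotent F L) {x z : L} {c : F}
    (hz : z ≠ 0) (h : bracket (F := F) x z = c • z) : c = 0 := by
  by_contra hc
  obtain ⟨n, hn⟩ := hnil
  have : ∀ n, z ∈ lowerCentral F L n := fun n => by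
    induction n with
    | zero => trivial
    | succ n ih =>
      have hz' : bracket (F := F) (c⁻¹ • x) z = z := by
        rw [map_smul, LinearMap.smul_apply, h, inv_smul_smul₀ hc]
      have := Submodule.apply_mem_map₂ (bracket (F := F) (L := L))
        (Submodule.mem_top (x := c⁻¹ • x)) ih
      rwa [hz'] at this
  have hzn := this n
  rw [hn] at hzn
  exact hz ((Submodule.mem_bot F).1 hzn)

theorem part_zero_eq_top (h : part (F := F) (L := L) 1 = ⊥) : part (F := F) (L := L) 0 = ⊤ := by
  have := (isCompl (F := F) (L := L)).sup_eq_top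
  rwa [h, sup_bot_eq] at this

theorem bracket_swap (h : part (F := F) (L := L) 1 = ⊥) (x y : L) :
    bracket (F := F) x y = - bracket (F := F) y x := by
  have ht := part_zero_eq_top h
  simpa using skew (F := F) 0 0 x y (ht ▸ trivial) (ht ▸ trivial)

/-- A Lie algebra spanned by `b`, `c` and the nonzero central element `[b, c]` is `H(1, 0)`. -/
theorem isomorphic_heisenberg_of_span [CharZero F] (h1 : part (F := F) (L := L) 1 = ⊥) {b c z : L}
    (hbc : bracket (F := F) b c = z) (hz : z ≠ 0) (hcen : ∀ x, bracket (F := F) x z = 0)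
    (hspan : ∀ x, x ∈ Submodule.span F {b, c, z}) : Isomorphic F L (Heisenberg F 1 0) := by
  have hself : ∀ x : L, bracket (F := F) x x = 0 := fun x => by
    have h2 : (2 : F) • bracket (F := F) x x = 0 := by
      rw [two_smul]
      exact eq_neg_iff_add_eq_zero.1 (bracket_swap h1 x x)
    exact (smul_eq_zero.1 h2).resolve_left two_ne_zero
  have hcen' : ∀ x : L, bracket (F := F) z x = 0 := fun x => by
    rw [bracket_swap h1, hcen, neg_zero]
  have hcb : bracket (F := F) c b = -z := by rw [bracket_swap h1, hbc]
  let g : Heisenberg F 1 0 →ₗ[F] L :=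
    (LinearMap.proj (HeisenbergBasis.u 0)).smulRight b +
      (LinearMap.proj (HeisenbergBasis.v 0)).smulRight c +
      (LinearMap.proj HeisenbergBasis.z).smulRight z
  have hg : ∀ x, g x = x (.u 0) • b + x (.v 0) • c + x .z • z := fun x => rfl
  have hbr : ∀ x y, bracket (F := F) (g x) (g y) =
      (x (.u 0) * y (.v 0) - x (.v 0) * y (.u 0)) • z := by
    intro x y
    rw [hg, hg]
    simp only [map_add, map_smul, LinearMap.add_apply, LinearMap.smul_apply, hself, hcen, hcen',
      hbc, hcb]
    module
  have hinj : Function.Injective g := by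
    rw [← LinearMap.ker_eq_bot, LinearMap.ker_eq_bot']
    intro x hx
    -- For `x` in the kernel, bracketing with the images of the basis vectors `v` and `u` isolates
    -- its `u` and `v` coordinates as multiples of `z ≠ 0`.
    have hu := hbr x (Pi.single (.v 0) 1)
    have hv := hbr (Pi.single (.u 0) 1) x
    rw [hx, map_zero] at hv
    rw [hx, map_zero, LinearMap.zero_apply] at hu
    replace hu : x (.u 0) = 0 := by simpa [hz] using hu.symm
    replace hv : x (.v 0) = 0 := by simpa [hz] using hv.symm
    have hz' := hg x
    rw [hx, hu, hv] at hz'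
    replace hz' : x .z = 0 := by simpa [hz] using hz'.symm
    funext k
    cases k with
    | u i => rw [Subsingleton.elim i 0]; exact hu
    | v i => rw [Subsingleton.elim i 0]; exact hv
    | z => exact hz'
    | w i => exact i.elim0
  have hsurj : Function.Surjective g := by
    intro x
    obtain ⟨α, β, γ, rfl⟩ := Submodule.mem_span_triple.1 (hspan x)
    refine ⟨fun k => match k with | .u _ => α | .v _ => β | .z => γ | .w _ => 0, ?_⟩
    rw [hg]
  let e := LinearEquiv.ofBijective g ⟨hinj, hsurj⟩
  have he : ∀ x, e x = g x := fun _ => rfl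
  refine ⟨e.symm, fun i x hx => ?_, fun x y => ?_⟩
  · fin_cases i
    · exact Heisenberg.mem_parity_zero.2 fun k => k.elim0
    · have : x = 0 := by
        have hx' : x ∈ part (F := F) (L := L) 1 := hx
        rwa [h1, Submodule.mem_bot] at hx'
      rw [this, map_zero]
      exact zero_mem _
  · obtain ⟨x, rfl⟩ := e.surjective x
    obtain ⟨y, rfl⟩ := e.surjective y
    simp only [LinearEquiv.coe_coe, LinearEquiv.symm_apply_apply]
    rw [LinearEquiv.symm_apply_eq, he, he, he, hbr, hg]
    change _ = (Heisenberg.form x y • Pi.single HeisenbergBasis.z (1 : F) : Heisenberg F 1 0) _ • _ +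
      (Heisenberg.form x y • Pi.single HeisenbergBasis.z (1 : F) : Heisenberg F 1 0) _ • _ +
      (Heisenberg.form x y • Pi.single HeisenbergBasis.z (1 : F) : Heisenberg F 1 0) _ • _
    simp [Heisenberg.form]

variable {K : Type w} [AddCommGroup K] [Module F K] [LieSuperalgebra F K]
variable [CharZero F] [FiniteDimensional F L] {f : K →ₗ[F] L} {B : L →ₗ[F] L →ₗ[F] K}

/-- For `z = [b, b]`, Jacobi on `b, b, b` reads `B(b, z) = B(z, b) - B(b, z)`, and `B(b, z) = -B(z,
b)` turns this into `3 B(z, b) = 0`. Maximality in odd degree then forces `z = 0`. -/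
theorem IsBracketLift.bracket_self_odd (hB : IsBracketLift f B) (hs : Function.Surjective f)
    (hcard : (sdimExteriorSquare F L).2 ≤ (sdim (derived F K)).2) {b : L}
    (hb : b ∈ part (F := F) 1) : bracket (F := F) b b = 0 := by
  by_contra hz
  have hb0 : b ≠ 0 := by rintro rfl; simp at hz
  have hz0 : bracket (F := F) b b ∈ part (F := F) 0 := bracket_mem 1 1 b b hb hb
  have hj := hB.jacobi 1 1 b b b hb hb
  have hsk := hB.skew 1 0 _ _ hb hz0
  simp only [ZMod.val_one, ZMod.val_zero, mul_zero, pow_zero, one_smul, mul_one, pow_one] at hj hsk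
  rw [hsk] at hj
  have h3 : (3 : F) • B (bracket (F := F) b b) b = 0 := by
    have h : (3 : F) • B (bracket (F := F) b b) b = B (bracket (F := F) b b) b +
        (-1 : F) • -B (bracket (F := F) b b) b - -B (bracket (F := F) b b) b := by module
    rw [h, ← hj, sub_self]
  exact hB.ne_zero_of_even_odd hs hcard hz0 hb hz hb0 ((smul_eq_zero.1 h3).resolve_left three_ne_zero)

/-- Polarisation of `bracket_self_odd`, the bracket being symmetric on the odd part. -/
theorem IsBracketLift.bracket_odd_odd (hB : IsBracketLift f B) (hs : Function.Surjective f)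
    (hcard : (sdimExteriorSquare F L).2 ≤ (sdim (derived F K)).2) {b c : L}
    (hb : b ∈ part (F := F) 1) (hc : c ∈ part (F := F) 1) : bracket (F := F) b c = 0 := by
  have h := hB.bracket_self_odd hs hcard (add_mem hb hc)
  have hsk := LieSuperalgebra.skew (F := F) 1 1 c b hc hb
  simp only [ZMod.val_one, mul_one, pow_one, neg_smul, one_smul, neg_neg] at hsk
  simp only [map_add, LinearMap.add_apply, hB.bracket_self_odd hs hcard hb,
    hB.bracket_self_odd hs hcard hc, hsk, zero_add, add_zero] at h
  rw [← two_smul F] at h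
  exact (smul_eq_zero.1 h).resolve_left two_ne_zero

/-- If `L² = ⟨z⟩` with `z` even, and the only relation on the brackets of `K` comes from `L`
being nonabelian, then `L` is `H(1, 0)`. -/
theorem IsBracketLift.isomorphic_heisenberg (hB : IsBracketLift f B)
    (hs : Function.Surjective f) (hnil : IsNilpotent F L) (hab : ¬ IsAbelian F L)
    (hcard0 : (sdimExteriorSquare F L).1 ≤ (sdim (derived F K)).1)
    (hcard1 : (sdimExteriorSquare F L).2 ≤ (sdim (derived F K)).2)
    (hd : sdim (derived F L) = (1, 0)) : Isomorphic F L (Heisenberg F 1 0) := by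
  have h01 : ∀ x ∈ part (F := F) (L := L) 0, ∀ y ∈ part (F := F) (L := L) 1,
      bracket (F := F) x y = 0 := fun x hx y hy =>
    eq_zero_of_mem_derived_one (congrArg Prod.snd hd) (mem_derived _ _)
      (by simpa using bracket_mem 0 1 _ _ hx hy)
  obtain ⟨b, hb, c, hc, hz⟩ : ∃ b ∈ part (F := F) (L := L) 0, ∃ c ∈ part (F := F) (L := L) 0,
      bracket (F := F) b c ≠ 0 := by
    by_contra! h
    exact hab (isAbelian_of_parts h h01 fun x hx y hy => hB.bracket_odd_odd hs hcard1 hx hy)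
  have hz0 : bracket (F := F) b c ∈ part (F := F) 0 := by simpa using bracket_mem 0 0 _ _ hb hc
  have h1 : part (F := F) (L := L) 1 = ⊥ := by
    rw [Submodule.eq_bot_iff]
    intro a ha
    by_contra ha0
    -- Even and odd elements commute in `L`, so only `B([b, c], a) = 0` is left.
    have hj := hB.jacobi 0 0 b c a hb hc
    simp only [h01 c hc a ha, h01 b hb a ha, map_zero, smul_zero, add_zero] at hj
    exact hB.ne_zero_of_even_odd hs hcard1 hz0 ha hz ha0 hj.symm
  have hbr := fun x y => bracket_swap h1 x y
  have ht := part_zero_eq_top h1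
  have ht' : ∀ x : L, x ∈ part (F := F) (L := L) 0 := fun x => ht ▸ trivial
  obtain ⟨z, hbc⟩ : ∃ z, bracket (F := F) b c = z := ⟨_, rfl⟩
  rw [hbc] at hz hz0
  have hmul : ∀ x y : L, ∃ r : F, bracket (F := F) x y = r • z := by
    have hfr : Module.finrank F ↥(derived F L ⊓ part (F := F) 0) = 1 := congrArg Prod.fst hd
    have hzd : z ∈ derived F L ⊓ part (F := F) 0 := ⟨hbc ▸ mem_derived _ _, hz0⟩
    intro x y
    obtain ⟨r, hr⟩ := (finrank_eq_one_iff_of_nonzero' (⟨z, hzd⟩ : ↥(derived F L ⊓ part (F := F) 0))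
      (by simpa [Subtype.ext_iff] using hz)).1 hfr ⟨_, mem_derived x y, ht' _⟩
    exact ⟨r, (congrArg Subtype.val hr).symm⟩
  -- `L²` is the line through `z`, so `z` is an eigenvector of every `[x, -]`, with eigenvalue zero
  -- by nilpotency.
  have hcen : ∀ x, bracket (F := F) x z = 0 := by
    intro x
    obtain ⟨r, hr⟩ := hmul x z
    rw [hr, hnil.eq_zero_of_bracket_eq_smul hz hr, zero_smul]
  refine isomorphic_heisenberg_of_span h1 hbc hz hcen fun a => ?_
  by_contra ha
  -- For `a` outside the span, the alternating form `χ ∧ ζ` is nonzero at `(a, z)` but vanishes on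
  -- pairs from `b, c, z`. Jacobi on `a, b, c` writes `B(a, z)` as a combination of `B(z, c)` and
  -- `B(b, z)`, a contradiction.
  obtain ⟨χ, hχa, hχ⟩ := Submodule.exists_dual_map_eq_bot_of_notMem ha inferInstance
  obtain ⟨ζ, hζ⟩ := not_forall.1 (mt (Module.forall_dual_apply_eq_zero_iff F z).1 hz)
  have hχ0 : ∀ x ∈ Submodule.span F {b, c, z}, χ x = 0 := fun x hx => by
    have := Submodule.mem_map_of_mem (f := χ) hx
    rwa [hχ, Submodule.mem_bot] at this
  have hχb : χ b = 0 := hχ0 _ (Submodule.subset_span (by simp))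
  have hχc : χ c = 0 := hχ0 _ (Submodule.subset_span (by simp))
  have hχz : χ z = 0 := hχ0 _ (Submodule.subset_span (by simp))
  obtain ⟨φ, hφ, -⟩ := hB.exists_dual_even hs hcard0
    ((LinearMap.mul F F).compl₁₂ χ ζ - (LinearMap.mul F F).compl₁₂ ζ χ) 0
    (fun x => by simp [mul_comm]) (fun _ _ => rfl)
  have hφ' : ∀ x y, φ (B x y) = χ x * ζ y - ζ x * χ y := fun x y => by
    simpa using hφ x (ht' x) y (ht' y)
  obtain ⟨r, hr⟩ := hmul a b
  obtain ⟨q, hq⟩ := hmul a c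
  have hj := congrArg φ (hB.jacobi 0 0 a b c (ht' a) (ht' b))
  rw [hbc, hr, hq] at hj
  simp [hφ', hχb, hχc, hχz, hζ, hχa] at hj

end Recognition

end LieSuperalgebra

namespace LieSuperalgebra

/-! ### The five-dimensional cover of `H(1, 0)` -/

section Cover

variable (F : Type u) [Field F]

/-- The underlying space of the free nilpotent Lie algebra of class three on two generators. -/
abbrev HeisenbergCover (F : Type u) : Type (max u v) := ULift.{v} (Fin 5) → F

/-- The bracket `[x₀, x₁] = x₂`, `[x₀, x₂] = x₃`, `[x₁, x₂] = x₄`. -/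
def heisenbergCoverBracket :
    HeisenbergCover.{u, v} F →ₗ[F] HeisenbergCover.{u, v} F →ₗ[F] HeisenbergCover.{u, v} F :=
  LinearMap.mk₂ F (fun x y k => ![0, 0, x ⟨0⟩ * y ⟨1⟩ - x ⟨1⟩ * y ⟨0⟩,
      x ⟨0⟩ * y ⟨2⟩ - x ⟨2⟩ * y ⟨0⟩, x ⟨1⟩ * y ⟨2⟩ - x ⟨2⟩ * y ⟨1⟩] k.down)
    (fun x x' y => by
      funext ⟨k⟩
      fin_cases k <;> simp <;> ring)
    (fun c x y => by
      funext ⟨k⟩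
      fin_cases k <;> simp <;> ring)
    (fun x y y' => by
      funext ⟨k⟩
      fin_cases k <;> simp <;> ring)
    (fun c x y => by
      funext ⟨k⟩
      fin_cases k <;> simp <;> ring)

instance : LieSuperalgebra F (HeisenbergCover.{u, v} F) where
  part i := if i = 0 then ⊤ else ⊥
  isCompl := by simpa using isCompl_top_bot
  bracket := heisenbergCoverBracket F
  bracket_mem i j x y hx hy := by
    by_cases hi : i = 0 <;> by_cases hj : j = 0 <;> simp_all
  skew i j x y hx hy := by
    by_cases hi : i = 0 <;> by_cases hj : j = 0 <;> simp_all
    funext ⟨k⟩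
    fin_cases k <;> simp [heisenbergCoverBracket] <;> ring
  jacobi i j x y z hx hy := by
    by_cases hi : i = 0 <;> by_cases hj : j = 0 <;> simp_all
    funext ⟨k⟩
    fin_cases k <;> simp [heisenbergCoverBracket] <;> ring

/-- The projection of the five-dimensional cover onto `H(1, 0)`. -/
def heisenbergCoverProj : HeisenbergCover.{u, v} F →ₗ[F] Heisenberg F 1 0 where
  toFun x
    | .u _ => x ⟨0⟩
    | .v _ => x ⟨1⟩
    | .z => x ⟨2⟩
    | .w _ => 0
  map_add' x y := by
    funext k
    cases k <;> simp
  map_smul' c x := by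
    funext k
    cases k <;> simp

theorem heisenbergCoverProj_surjective :
    Function.Surjective (heisenbergCoverProj.{u, v} F) := by
  intro y
  refine ⟨fun k => ![y (.u 0), y (.v 0), y .z, 0, 0] k.down, ?_⟩
  funext k
  cases k with
  | u i => rw [Subsingleton.elim i 0]; rfl
  | v i => rw [Subsingleton.elim i 0]; rfl
  | z => rfl
  | w i => exact i.elim0

theorem heisenbergCoverProj_isHom : IsHom (heisenbergCoverProj.{u, v} F) := by
  refine ⟨fun i x hx => ?_, fun x y => ?_⟩
  · fin_cases i
    · exact Heisenberg.mem_parity_zero.2 fun k => k.elim0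
    · have : x = 0 := hx
      rw [this, map_zero]
      exact zero_mem _
  · change heisenbergCoverProj F (heisenbergCoverBracket F x y) = Heisenberg.heisenbergBracket F 1 0 _ _
    rw [Heisenberg.bracket_apply]
    funext k
    cases k <;> simp [heisenbergCoverProj, heisenbergCoverBracket, Heisenberg.form]

theorem mem_ker_heisenbergCoverProj {x : HeisenbergCover.{u, v} F}
    (hx : x ∈ LinearMap.ker (heisenbergCoverProj F)) : x ⟨0⟩ = 0 ∧ x ⟨1⟩ = 0 ∧ x ⟨2⟩ = 0 :=
  ⟨congrFun (LinearMap.mem_ker.1 hx) (.u 0), congrFun (LinearMap.mem_ker.1 hx) (.v 0),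
    congrFun (LinearMap.mem_ker.1 hx) .z⟩

theorem ker_heisenbergCoverProj_le :
    LinearMap.ker (heisenbergCoverProj.{u, v} F) ≤ center F (HeisenbergCover.{u, v} F) ⊓
      derived F (HeisenbergCover.{u, v} F) := by
  intro x hx
  obtain ⟨h0, h1, h2⟩ := mem_ker_heisenbergCoverProj F hx
  constructor
  · refine LinearMap.mem_ker.2 (LinearMap.ext fun y => ?_)
    change heisenbergCoverBracket F x y = 0
    funext ⟨k⟩
    fin_cases k <;> simp [heisenbergCoverBracket, h0, h1, h2]
  · have h : x = bracket (F := F) (L := HeisenbergCover.{u, v} F) (Pi.single ⟨0⟩ (x ⟨3⟩))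
          (Pi.single ⟨2⟩ 1) +
        bracket (F := F) (L := HeisenbergCover.{u, v} F) (Pi.single ⟨1⟩ (x ⟨4⟩))
          (Pi.single ⟨2⟩ 1) := by
      change x = heisenbergCoverBracket F _ _ + heisenbergCoverBracket F _ _
      funext ⟨k⟩
      fin_cases k <;> simp [heisenbergCoverBracket, h0, h1, h2]
    rw [h]
    exact add_mem (mem_derived _ _) (mem_derived _ _)

theorem finrank_heisenberg : Module.finrank F (Heisenberg F 1 0) = 3 := by
  rw [Module.finrank_fintype_fun_eq_card]
  rfl

theorem sdim_ker_heisenbergCoverProj :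
    sdim (LinearMap.ker (heisenbergCoverProj.{u, v} F)) = (2, 0) := by
  have h := (heisenbergCoverProj.{u, v} F).finrank_range_add_finrank_ker
  rw [LinearMap.range_eq_top.2 (heisenbergCoverProj_surjective F), finrank_top,
    finrank_heisenberg, Module.finrank_fintype_fun_eq_card, Fintype.card_ulift,
    Fintype.card_fin] at h
  have h0 : part (F := F) (L := HeisenbergCover.{u, v} F) 0 = ⊤ := rfl
  have h1 : part (F := F) (L := HeisenbergCover.{u, v} F) 1 = ⊥ := rfl
  rw [sdim, h0, h1, inf_top_eq, inf_bot_eq, finrank_bot]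
  congr 1
  omega

end Cover

/-! ### The multiplier of `H(1, 0)` and the formula for `smr` -/

section Heisenberg

variable {F : Type u} [Field F]
variable {L : Type v} [AddCommGroup L] [Module F L] [LieSuperalgebra F L]

theorem Isomorphic.part_one_eq_bot (h : Isomorphic F L (Heisenberg F 1 0)) :
    part (F := F) (L := L) 1 = ⊥ := by
  obtain ⟨e, he⟩ := h
  rw [Submodule.eq_bot_iff]
  intro x hx
  obtain ⟨hu, hv, hz⟩ := Heisenberg.mem_parity_one.1 (he.1 1 x hx)
  refine e.map_eq_zero_iff.1 (funext fun k => ?_)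
  cases k with
  | u i => exact hu i
  | v i => exact hv i
  | z => exact hz
  | w i => exact i.elim0

theorem Isomorphic.sdim_top (h : Isomorphic F L (Heisenberg F 1 0)) :
    sdim (⊤ : Submodule F L) = (3, 0) := by
  rw [LieSuperalgebra.sdim_top, part_zero_eq_top h.part_one_eq_bot, h.part_one_eq_bot,
    finrank_top, finrank_bot]
  obtain ⟨e, -⟩ := h
  rw [e.finrank_eq, finrank_heisenberg]

theorem Isomorphic.mem_definingSdims (h : Isomorphic F L (Heisenberg F 1 0)) :
    (2, 0) ∈ definingSdims F L := by
  have h1 := h.part_one_eq_bot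
  obtain ⟨e, he⟩ := h
  have hp := heisenbergCoverProj_isHom.{u, v} F
  have hker : LinearMap.ker ((e.symm : Heisenberg F 1 0 →ₗ[F] L) ∘ₗ heisenbergCoverProj.{u, v} F) =
      LinearMap.ker (heisenbergCoverProj.{u, v} F) :=
    LinearMap.ker_comp_of_ker_eq_bot _ e.symm.ker
  -- Indexing the cover by a lifted `Fin 5` places it in the universe over which `definingSdims`
  -- ranges.
  refine ⟨HeisenbergCover.{u, v} F, inferInstance, inferInstance, inferInstance,
    LinearMap.ker (heisenbergCoverProj F), ⟨⟨(e.symm : Heisenberg F 1 0 →ₗ[F] L) ∘ₗ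
      heisenbergCoverProj F, ⟨fun i x hx => ?_, fun x y => ?_⟩,
      e.symm.surjective.comp (heisenbergCoverProj_surjective F), hker⟩,
    ker_heisenbergCoverProj_le F⟩, sdim_ker_heisenbergCoverProj F⟩
  · fin_cases i
    · exact part_zero_eq_top h1 ▸ trivial
    · have : x = 0 := hx
      rw [this, map_zero]
      exact zero_mem _
  · simp only [LinearMap.comp_apply, LinearEquiv.coe_coe, LinearEquiv.symm_apply_eq]
    rw [hp.2]
    have := he.2 (e.symm (heisenbergCoverProj F x)) (e.symm (heisenbergCoverProj F y))
    simpa using this.symm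

variable [FiniteDimensional F L]

variable (F L) in
theorem sdimMultiplier_spec : Maximal (fun d => d ∈ definingSdims F L) (sdimMultiplier F L) :=
  (exists_maximal_definingSdims F L).choose_spec

variable (F L) in
theorem smr_eq : smr F L =
    (((sdimExteriorSquare F L).1 : ℤ) - (sdimMultiplier F L).1,
      ((sdimExteriorSquare F L).2 : ℤ) - (sdimMultiplier F L).2) := by
  -- Truncated and integer `n - 1` differ only at `n = 0`, where the factor `n` makes both products
  -- zero.
  have h : ∀ n : ℕ, (n : ℤ) * (n - 1) / 2 = ((n * (n - 1) / 2 : ℕ) : ℤ) := fun n => by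
    cases n <;> simp
  simp only [smr, sdimExteriorSquare, h]
  push_cast
  rfl

variable [CharZero F]

theorem IsDefiningPair.sdim_add_le {K : Type w} [AddCommGroup K] [Module F K]
    [LieSuperalgebra F K] {M : Submodule F K} (h : IsDefiningPair L M) :
    sdim M + sdim (derived F L) ≤ sdimExteriorSquare F L := by
  rw [h.sdim_add]
  obtain ⟨⟨f, hf, hs, rfl⟩, hM⟩ := h
  obtain ⟨B, hB⟩ := hf.exists_isBracketLift hs (hM.trans inf_le_left)
  exact hB.sdim_derived_le hs

/-- Here `sdim Λ = (3, 0)` and `L²` has nonzero even part, so `sdim M ≤ (2, 0)`. The cover attains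
`(2, 0)`, and maximality gives equality. -/
theorem Isomorphic.sdimMultiplier_eq (h : Isomorphic F L (Heisenberg F 1 0))
    (hab : ¬ IsAbelian F L) : sdimMultiplier F L = (2, 0) := by
  have hspec := sdimMultiplier_spec F L
  obtain ⟨K, _, _, _, M, hM, hd⟩ := hspec.1
  have hle := hM.sdim_add_le
  rw [hd, sdimExteriorSquare, h.sdim_top] at hle
  have h1 := hle.1
  have h2 := hle.2
  simp only [Prod.fst_add, Prod.snd_add] at h1 h2
  have h0 : (sdim (derived F L)).1 ≠ 0 := fun h0 => hab fun x y => by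
    refine eq_zero_of_mem_derived_zero h0 (mem_derived _ _) ?_
    exact part_zero_eq_top h.part_one_eq_bot ▸ trivial
  exact hspec.eq_of_le h.mem_definingSdims ⟨by omega, by omega⟩

end Heisenberg

end LieSuperalgebra

/-- A finite-dimensional non-abelian nilpotent Lie superalgebra never has super-multiplier-rank
`(0, 1)`, and it has super-multiplier-rank `(1, 0)` exactly if it is isomorphic to `H(1, 0)`. -/
theorem proposition13 {F : Type u} [Field F] [IsAlgClosed F] [CharZero F]
    {L : Type v} [AddCommGroup L] [Module F L] [LieSuperalgebra F L] [FiniteDimensional F L]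
    (hnil : LieSuperalgebra.IsNilpotent F L) (hab : ¬ LieSuperalgebra.IsAbelian F L) :
    LieSuperalgebra.smr F L ≠ (0, 1) ∧
      (LieSuperalgebra.smr F L = (1, 0) ↔
        LieSuperalgebra.Isomorphic F L (LieSuperalgebra.Heisenberg F 1 0)) := by
  open LieSuperalgebra in
  obtain ⟨K, _, _, _, M, hM, hd⟩ := (sdimMultiplier_spec F L).1
  have hadd := hM.sdim_add
  have hle := hM.sdim_add_le
  obtain ⟨⟨f, hf, hs, rfl⟩, hM⟩ := hM
  obtain ⟨B, hB⟩ := hf.exists_isBracketLift hs (hM.trans inf_le_left)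
  rw [hd] at hadd hle
  have hadd0 := congrArg Prod.fst hadd
  have hadd1 := congrArg Prod.snd hadd
  have hle0 := hle.1
  have hle1 := hle.2
  simp only [Prod.fst_add, Prod.snd_add] at hadd0 hadd1 hle0 hle1
  rw [smr_eq]
  refine ⟨fun h => ?_, fun h => ?_, fun h => ?_⟩
  -- The even component of `sdim M` already equals that of `sdim Λ`, leaving no room for an even
  -- part of `L²` and making the even part of `K²` maximal.
  · have h0 := congrArg Prod.fst h
    simp only at h0
    exact hab (hB.isAbelian_of_derived_odd hs (by omega) (by omega))
  · have h0 := congrArg Prod.fst h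
    have h1 := congrArg Prod.snd h
    simp only at h0 h1
    have hd1 : (sdim (derived F L)).2 = 0 := by omega
    -- The bound leaves `0` or `1`; `0` would make `L²` vanish, its odd part being zero already.
    -- With `1`, the even part of `K²` is maximal.
    have hd0 : (sdim (derived F L)).1 = 1 := by
      have : (sdim (derived F L)).1 ≠ 0 := fun h0' => hab fun x y => by
        have hle := derived_le_sup (mem_derived (F := F) x y)
        rw [Submodule.finrank_eq_zero.1 h0', Submodule.finrank_eq_zero.1 hd1, sup_bot_eq] at hle
        exact (Submodule.mem_bot F).1 hle
      omega
    exact hB.isomorphic_heisenberg hs hnil hab (by omega) (by omega) (Prod.ext hd0 hd1)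
  · rw [h.sdimMultiplier_eq hab, sdimExteriorSquare, h.sdim_top]
    norm_num
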